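/- Let $k,n\ge 1$. A $(k,k)$-parking function of length $n$ is a sequence $\pi=(\pi_1,\dots,\pi_n)$ of positive integers whose weakly increasing rearrangement $\lambda_1\le\dots\le\lambda_n$ satisfies $\lambda_i\le k+(i-1)k=ik$ for all $1\le i\le n$. For such $\pi$, let $B_\pi(x)=\{j:\pi_j=x\}$, let $\#x=|B_\pi(x)|$, let $\ell(\pi)=\lceil \pi_1/k\rceil$ be the index of the leading block, and for $1\le i\le n$ let $$S_\pi(i)=(B_\pi(ik-k+1),B_\pi(ik-k+2),\dots,B_\pi(ik)).$$ Put $$\mathcal O(\pi)=\{S_\pi(i): 1\le i\le n,\ i\ne 1,\ i\neq\ell(\pi),\ S_\pi(i)\ne(\emptyset,\dots,\emptyset)\}.$$ Fix a finite (possibly empty) set $\mathcal O$ of vectors of length $k$ with entries in the subsets of $\{1,\dots,n\}$, such that no vector in $\mathcal O$ is $(\emptyset,\dots,\emptyset)$, all the nonempty entries of the vectors in $\mathcal O$ are mutually disjoint, and their union is a subset of $\{2,\dots,n\}$. Then $(\#1,\dots,\#k)$ and $(\#(\ell(\pi)k-k+1),\dots,\#(\ell(\pi)k))$ have a symmetric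 joint distribution over all $(k,k)$-parking functions $\pi$ of length $n$ with $\mathcal O(\pi)=\mathcal O$. That is, for all vectors $u,v$ of $k$ nonnegative integers, the number of such $\pi$ with $(\#1,\dots,\#k)=u$ and $(\#(\ell(\pi)k-k+1),\dots,\#(\ell(\pi)k))=v$ equals the number of such $\pi$ with $(\#1,\dots,\#k)=v$ and $(\#(\ell(\pi)k-k+1),\dots,\#(\ell(\pi)k))=u$. -/

import Mathlib

/-- The weakly increasing rearrangement `λ₁ ≤ λ₂ ≤ ⋯ ≤ λₙ` of a sequence of length `n`
(entry `λᵢ` is found at the index `i - 1`). -/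
def increasingRearrangement {n : ℕ} (π : Fin n → ℕ) : Fin n → ℕ :=
  π ∘ Tuple.sort π

/-- `π` is an `(a, b)`-parking function of length `n`: a sequence of positive integers whose
weakly increasing rearrangement satisfies `λᵢ ≤ a + (i - 1) b` for `1 ≤ i ≤ n`.
Car `j` of `1, …, n` is the element `j - 1` of `Fin n`; spots are numbered from `1`. -/
def IsABParkingFunction (a b : ℕ) {n : ℕ} (π : Fin n → ℕ) : Prop :=
  (∀ j, 1 ≤ π j) ∧ ∀ i : Fin n, increasingRearrangement π i ≤ a + (i : ℕ) * b

theorem finite_setOf_isABParkingFunction (a b n : ℕ) :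
    {π : Fin n → ℕ | IsABParkingFunction a b π}.Finite := by
  refine (Set.finite_Iic (fun _ : Fin n => a + n * b)).subset ?_
  rintro π ⟨-, h⟩ j
  have h1 := h ((Tuple.sort π).symm j)
  simp only [increasingRearrangement, Function.comp_apply, Equiv.apply_symm_apply] at h1
  exact h1.trans (Nat.add_le_add_left (Nat.mul_le_mul_right b (Fin.is_lt _).le) a)

/-- The finite set `PF(a, b, n)` of `(a, b)`-parking functions of length `n`. -/
noncomputable def abParkingFunctions (a b n : ℕ) : Finset (Fin n → ℕ) :=
  (finite_setOf_isABParkingFunction a b n).toFinset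

/-- `B_π(x)`, the set of cars that prefer spot `x`. -/
def carsPreferring {n : ℕ} (π : Fin n → ℕ) (x : ℕ) : Finset (Fin n) :=
  Finset.univ.filter fun j => π j = x

/-- `S_π(i) = (B_π(ik-k+1), B_π(ik-k+2), …, B_π(ik))`, for a block index `i ≥ 1`. -/
def blockVector (k : ℕ) {n : ℕ} (π : Fin n → ℕ) (i : ℕ) : Fin k → Finset (Fin n) :=
  fun c => carsPreferring π (i * k - k + ((c : ℕ) + 1))

/-- `(#(ik-k+1), …, #(ik))`: the numbers of occurrences in `π` of the elements of the
`i`-th block, for a block index `i ≥ 1`. -/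
def blockCounts (k : ℕ) {n : ℕ} (π : Fin n → ℕ) (i : ℕ) : Fin k → ℕ :=
  fun c => (carsPreferring π (i * k - k + ((c : ℕ) + 1))).card

/-- The index `ℓ(π) = ⌈π₁ / k⌉` of the leading block (`π₁`, the preference of the first car,
is `π 0`). -/
def leadingBlock (k : ℕ) {n : ℕ} [NeZero n] (π : Fin n → ℕ) : ℕ :=
  π 0 ⌈/⌉ k

/-- `𝒪(π) = {S_π(i) : i ≠ 1, ℓ(π), S_π(i) ≠ (∅, …, ∅)}`, where `i` runs through the indices
`1, …, n` of the blocks of `{1, …, kn}`. -/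
def otherBlockVectors (k : ℕ) {n : ℕ} [NeZero n] (π : Fin n → ℕ) :
    Finset (Fin k → Finset (Fin n)) :=
  ((Finset.Icc 1 n).filter fun i =>
    i ≠ 1 ∧ i ≠ leadingBlock k π ∧ blockVector k π i ≠ fun _ => ∅).image (blockVector k π)

/-- The statistics `X` and `Y` have a symmetric joint distribution over the finite set `A`:
`(X, Y)` and `(Y, X)` are equidistributed on `A`. -/
def HasSymmetricJointDistribution {α β : Type*} [DecidableEq β] (A : Finset α)
    (X Y : α → β) : Prop :=
  ∀ u v : β, (A.filter fun π => X π = u ∧ Y π = v).card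
    = (A.filter fun π => X π = v ∧ Y π = u).card

/-! Only `u ≠ v` needs an argument, and then the leading block is not the first one. Write `|u|` for
the sum of the entries of `u`. A parking function to be counted amounts to two choices. A colouring
distributes the cars outside the entries of `𝒪` over the first and the leading block, with
occupation numbers `u` and `v` and with car 1 in the leading block. A word then arranges the vectors
of `𝒪`, the leading vector and empty vectors in the blocks `2, …, n`.

The parking condition sees only the block sizes: a walk that starts at `|u|`, gains the size of each
later block and loses 1 per block must stay positive. Since all sizes add up to `n`, the cycle lemma
`succ_mul_card_ballotWords` shows that `n` times the number of words is `|u| * n.descFactorial (|𝒪|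
+ 1)`, whatever the individual sizes.

It remains to see that `|u|` times the number of colourings is unchanged when `u` and `v` are
swapped (`card_blockColourings_mul_sum`). This product counts colourings with a marked car in the
first block; exchanging that car with car 1, and the two blocks with each other, swaps `u` and `v`.
-/

/-! ### Ballot words and the cycle lemma -/

/-- The words `w` of length `N` in which every letter of `X` occurs exactly once, all other letters
are the blank letter `e`, and a walk that starts at height `p`, gains `s (w i)` and loses `1` in
step `i`, stays positive. -/
def ballotWords {ι : Type*} [Fintype ι] [DecidableEq ι] (e : ι) (s : ι → ℕ) (N p : ℕ)
    (X : Finset ι) : Finset (Fin N → ι) :=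
  Finset.univ.filter fun w =>
    (∀ y, y ≠ e → (∑ i, if w i = y then 1 else 0) = if y ∈ X then 1 else 0) ∧
      ∀ t, t ≤ N → t < p + ∑ i : Fin N, if (i : ℕ) < t then s (w i) else 0

theorem mem_ballotWords {ι : Type*} [Fintype ι] [DecidableEq ι] {e : ι} {s : ι → ℕ} {N p : ℕ}
    {X : Finset ι} {w : Fin N → ι} : w ∈ ballotWords e s N p X ↔
    (∀ y, y ≠ e → (∑ i, if w i = y then 1 else 0) = if y ∈ X then 1 else 0) ∧
      ∀ t, t ≤ N → t < p + ∑ i : Fin N, if (i : ℕ) < t then s (w i) else 0 := by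
  simp [ballotWords]

/-- The first step leads from height `p + 1` to `p + s a`; the condition at time 0 is automatic on
the left. -/
theorem ballot_condition_cons {ι : Type*} (s : ι → ℕ) (N p : ℕ) (a : ι) (w : Fin N → ι) :
    (∀ t, t ≤ N + 1 → t < p + 1 + ∑ i : Fin (N + 1),
        if (i : ℕ) < t then s ((Fin.cons a w : Fin (N + 1) → ι) i) else 0) ↔
      ∀ t, t ≤ N → t < p + s a + ∑ i : Fin N, if (i : ℕ) < t then s (w i) else 0 := by
  simp only [Fin.sum_univ_succ, Fin.cons_zero, Fin.cons_succ, Fin.val_zero, Fin.val_succ]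
  constructor
  · intro h t ht
    have := h (t + 1) (by omega)
    simp only [Nat.succ_pos, if_true, Nat.add_lt_add_iff_right] at this
    omega
  · intro h t ht
    cases t with
    | zero => omega
    | succ t =>
      have := h t (by omega)
      simp only [Nat.succ_pos, if_true, Nat.add_lt_add_iff_right]
      omega

theorem cons_blank_mem_ballotWords {ι : Type*} [Fintype ι] [DecidableEq ι] {e : ι} {s : ι → ℕ}
    {N p : ℕ} {X : Finset ι} (he : s e = 0) (w : Fin N → ι) :
    (Fin.cons e w : Fin (N + 1) → ι) ∈ ballotWords e s (N + 1) (p + 1) X ↔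
      w ∈ ballotWords e s N p X := by
  rw [mem_ballotWords, mem_ballotWords, ballot_condition_cons, he, add_zero]
  refine and_congr_left' (forall₂_congr fun y hy => ?_)
  rw [Fin.sum_univ_succ]
  simp only [Fin.cons_zero, Fin.cons_succ, hy.symm, if_false, zero_add]

theorem cons_letter_mem_ballotWords {ι : Type*} [Fintype ι] [DecidableEq ι] {e : ι} {s : ι → ℕ}
    {N p : ℕ} {X : Finset ι} {x : ι} (hx : x ∈ X) (w : Fin N → ι) :
    (Fin.cons x w : Fin (N + 1) → ι) ∈ ballotWords e s (N + 1) (p + 1) X ↔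
      w ∈ ballotWords e s N (p + s x) (X.erase x) := by
  rw [mem_ballotWords, mem_ballotWords, ballot_condition_cons]
  refine and_congr_left' (forall₂_congr fun y hy => ?_)
  rw [Fin.sum_univ_succ]
  simp only [Fin.cons_zero, Fin.cons_succ, Finset.mem_erase]
  by_cases hxy : x = y
  · subst hxy
    simp [hx]
  · simp [hxy, Ne.symm hxy]

theorem cons_notMem_ballotWords {ι : Type*} [Fintype ι] [DecidableEq ι] {e : ι} {s : ι → ℕ}
    {N p : ℕ} {X : Finset ι} {x : ι} (hx : x ∉ X) (hxe : x ≠ e) (w : Fin N → ι) :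
    (Fin.cons x w : Fin (N + 1) → ι) ∉ ballotWords e s N.succ p X := by
  rw [mem_ballotWords]
  rintro ⟨h, -⟩
  have := h x hxe
  rw [Fin.sum_univ_succ] at this
  simp [hx] at this

/-- The first letter is either blank or a letter of `X`, which is then used up. -/
theorem card_ballotWords_succ {ι : Type*} [Fintype ι] [DecidableEq ι] {e : ι} {s : ι → ℕ}
    {N p : ℕ} {X : Finset ι} (he : s e = 0) (heX : e ∉ X) :
    (ballotWords e s (N + 1) (p + 1) X).card = (ballotWords e s N p X).card +
      ∑ x ∈ X, (ballotWords e s N (p + s x) (X.erase x)).card := by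
  have h1 : (ballotWords e s (N + 1) (p + 1) X).card =
      ∑ a : ι, (Finset.univ.filter fun w : Fin N → ι =>
        (Fin.cons a w : Fin (N + 1) → ι) ∈ ballotWords e s (N + 1) (p + 1) X).card := by
    simp only [Finset.card_filter]
    rw [← Fintype.sum_prod_type']
    refine Eq.trans ?_ (Fintype.sum_equiv (Fin.consEquiv fun _ : Fin (N + 1) => ι) _
        (fun w => if w ∈ ballotWords e s (N + 1) (p + 1) X then 1 else 0) (fun _ => rfl)).symm
    rw [← Finset.card_filter, Finset.filter_univ_mem]
  rw [h1, ← Finset.sum_subset (Finset.subset_univ (insert e X)), Finset.sum_insert heX]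
  · congr 1
    · simp only [cons_blank_mem_ballotWords he, Finset.filter_univ_mem]
    · refine Finset.sum_congr rfl fun x hx => ?_
      simp only [cons_letter_mem_ballotWords hx, Finset.filter_univ_mem]
  · intro x _ hx
    rw [Finset.mem_insert, not_or] at hx
    exact Finset.card_eq_zero.2 (Finset.filter_eq_empty_iff.2 fun w _ =>
      cons_notMem_ballotWords hx.2 hx.1 w)

/-- A form of the cycle lemma. -/
theorem succ_mul_card_ballotWords {ι : Type*} [Fintype ι] [DecidableEq ι] {e : ι} {s : ι → ℕ}
    (he : s e = 0) (hs : ∀ x, x ≠ e → 0 < s x) (N p : ℕ) (X : Finset ι) (heX : e ∉ X)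
    (hsum : p + ∑ x ∈ X, s x = N + 1) :
    (N + 1) * (ballotWords e s N p X).card = p * (N + 1).descFactorial X.card := by
  induction N generalizing p X with
  | zero =>
    -- The total is 1 and letters have positive weight, so either `p = 0`, or `p = 1` and `X` is
    -- empty.
    have hX : X.card ≤ ∑ x ∈ X, s x := by
      rw [Finset.card_eq_sum_ones]
      exact Finset.sum_le_sum fun x hx => hs x (ne_of_mem_of_not_mem hx heX)
    rcases Nat.eq_zero_or_pos p with rfl | hp
    · rw [zero_mul, mul_eq_zero, Finset.card_eq_zero]
      right
      rw [Finset.eq_empty_iff_forall_notMem]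
      intro w hw
      simpa using (mem_ballotWords.1 hw).2 0 le_rfl
    · have hc : X.card = 0 := by omega
      have hp1 : p = 1 := by omega
      rw [Finset.card_eq_zero] at hc
      subst hc hp1
      have : ballotWords e s 0 1 ∅ = Finset.univ := by
        ext w
        simp [mem_ballotWords, -Finset.univ_unique]
      rw [this]
      simp
  | succ N ih =>
    cases p with
    | zero =>
      rw [zero_mul, mul_eq_zero, Finset.card_eq_zero]
      right
      rw [Finset.eq_empty_iff_forall_notMem]
      intro w hw
      simpa using (mem_ballotWords.1 hw).2 0 (Nat.zero_le _)
    | succ p =>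
      have hrec := card_ballotWords_succ (N := N) (p := p) he heX
      have h0 := ih p X heX (by omega)
      have hx : ∀ x ∈ X, (N + 1) * (ballotWords e s N (p + s x) (X.erase x)).card =
          (p + s x) * (N + 1).descFactorial (X.card - 1) := by
        intro x hx
        have := Finset.add_sum_erase X s hx
        rw [ih (p + s x) (X.erase x) (fun h => heX (Finset.mem_of_mem_erase h)) (by omega),
          Finset.card_erase_of_mem hx]
      -- Both kinds of shorter word still satisfy the hypothesis on the total, because moving `s x`
      -- from `X` into the height preserves it.
      have key : (N + 1) * (ballotWords e s (N + 1) (p + 1) X).card =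
          p * (N + 1).descFactorial X.card +
            (X.card * p + ∑ x ∈ X, s x) * (N + 1).descFactorial (X.card - 1) := by
        rw [hrec, mul_add, h0, Finset.mul_sum, Finset.sum_congr rfl hx, ← Finset.sum_mul,
          Finset.sum_add_distrib, Finset.sum_const, smul_eq_mul]
      refine Nat.eq_of_mul_eq_mul_left (Nat.succ_pos N) ?_
      rw [Nat.succ_eq_add_one, mul_left_comm, key]
      rcases hm : X.card with _ | m
      · rw [Finset.card_eq_zero] at hm
        subst hm
        simp only [Finset.sum_empty, Nat.descFactorial_zero] at hsum ⊢
        have : p = N + 1 := by omega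
        subst this
        ring
      · rw [Nat.succ_descFactorial_succ (N + 1) m, Nat.descFactorial_succ (N + 1) m, Nat.add_sub_cancel]
        -- With more than `N + 1` letters left, both sides vanish; otherwise `d = N + 1 - m` is an
        -- honest difference.
        rcases lt_or_ge (N + 1) m with hlt | hle
        · simp [Nat.descFactorial_of_lt hlt]
        · obtain ⟨d, hd⟩ := Nat.exists_eq_add_of_le hle
          rw [hd, Nat.add_sub_cancel_left]
          have e1 : p + ∑ x ∈ X, s x = m + d := by omega
          have e2 : p * d + ((m + 1) * p + ∑ x ∈ X, s x) = (m + d) * (p + 1) := by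
            have : p * d + ((m + 1) * p + ∑ x ∈ X, s x) =
              p * d + m * p + (p + ∑ x ∈ X, s x) := by ring
            rw [this, e1]; ring
          calc _ = (m + 1 + d) * ((p * d + ((m + 1) * p + ∑ x ∈ X, s x)) *
                (m + d).descFactorial m) := by ring
            _ = _ := by rw [e2]; ring

/-- Counting occurrences suits the removal of a first letter; the right-hand form suits the
comparison with blocks of a parking function. -/
theorem sum_ite_eq_ite_mem_iff {ι : Type*} [DecidableEq ι] {e : ι} {N : ℕ} {X : Finset ι}
    {w : Fin N → ι} :
    (∀ y, y ≠ e → (∑ i, if w i = y then 1 else 0) = if y ∈ X then 1 else 0) ↔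
      (∀ y, y ≠ e → (y ∈ X ↔ ∃ i, w i = y)) ∧ ∀ i i', w i = w i' → w i ≠ e → i = i' := by
  simp only [← Finset.card_filter]
  constructor
  · intro h
    constructor
    · intro y hy
      have := h y hy
      by_cases hX : y ∈ X
      · rw [if_pos hX] at this
        obtain ⟨i, hi⟩ := Finset.card_pos.1 (this ▸ Nat.one_pos)
        exact ⟨fun _ => ⟨i, by simpa using hi⟩, fun _ => hX⟩
      · rw [if_neg hX, Finset.card_eq_zero, Finset.filter_eq_empty_iff] at this
        exact ⟨fun h => absurd h hX, fun ⟨i, hi⟩ => absurd hi (this (Finset.mem_univ i))⟩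
    · intro i i' hii' hi
      have h1 : (Finset.univ.filter fun l => w l = w i).card ≤ 1 := by
        rw [h _ hi]; split_ifs <;> simp
      exact Finset.card_le_one.1 h1 i (by simp) i' (by simp [hii'])
  · rintro ⟨h1, h2⟩ y hy
    by_cases hX : y ∈ X
    · rw [if_pos hX, Finset.card_eq_one]
      obtain ⟨i, hi⟩ := (h1 y hy).1 hX
      refine ⟨i, ?_⟩
      ext l
      rw [Finset.mem_filter, Finset.mem_singleton]
      exact ⟨fun hl => h2 l i (hl.2.trans hi.symm) (hl.2.symm ▸ hy),
        fun hl => ⟨Finset.mem_univ _, hl ▸ hi⟩⟩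
    · rw [if_neg hX, Finset.card_eq_zero, Finset.filter_eq_empty_iff]
      exact fun i _ hi => hX ((h1 y hy).2 ⟨i, hi⟩)

/-! ### Colourings and the exchange of the two blocks -/

/-- The ways to distribute the cars outside `U` over the spots `(false, c)` of one block and the
spots `(true, c)` of another block which takes the first car, with occupation numbers `u`, `v`. -/
noncomputable def blockColourings (k : ℕ) {n : ℕ} [NeZero n] (U : Finset (Fin n)) (u v : Fin k → ℕ) :
    Finset (Fin n → Option (Bool × Fin k)) :=
  Finset.univ.filter fun f => (∀ i, f i = none ↔ i ∈ U) ∧ (∃ c, f 0 = some (true, c)) ∧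
    (∀ c, (Finset.univ.filter fun i => f i = some (false, c)).card = u c) ∧
    ∀ c, (Finset.univ.filter fun i => f i = some (true, c)).card = v c

theorem mem_blockColourings {k n : ℕ} [NeZero n] {U : Finset (Fin n)} {u v : Fin k → ℕ}
    {f : Fin n → Option (Bool × Fin k)} : f ∈ blockColourings k U u v ↔
    (∀ i, f i = none ↔ i ∈ U) ∧ (∃ c, f 0 = some (true, c)) ∧
    (∀ c, (Finset.univ.filter fun i => f i = some (false, c)).card = u c) ∧
    ∀ c, (Finset.univ.filter fun i => f i = some (true, c)).card = v c := by
  simp [blockColourings]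

theorem card_filter_exists_eq_sum {k n : ℕ} (f : Fin n → Option (Bool × Fin k)) (b : Bool) :
    (Finset.univ.filter fun i => ∃ c, f i = some (b, c)).card =
      ∑ c, (Finset.univ.filter fun i => f i = some (b, c)).card := by
  rw [← Finset.card_biUnion]
  · congr 1
    ext i
    simp
  · intro c _ d _ hcd
    rw [Function.onFun, Finset.disjoint_filter]
    intro i _ h1 h2
    rw [h1] at h2
    simp only [Option.some.injEq, Prod.mk.injEq, true_and] at h2
    exact hcd h2

/-- Exchange the first car with the car `j` and the two blocks with each other. -/
def exchangeBlocks {k n : ℕ} [NeZero n] (j : Fin n) (f : Fin n → Option (Bool × Fin k)) :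
    Fin n → Option (Bool × Fin k) :=
  fun i => (f (Equiv.swap 0 j i)).map (Prod.map Bool.not id)

theorem exchangeBlocks_exchangeBlocks {k n : ℕ} [NeZero n] (j : Fin n)
    (f : Fin n → Option (Bool × Fin k)) : exchangeBlocks j (exchangeBlocks j f) = f := by
  funext i
  simp only [exchangeBlocks, Equiv.swap_apply_self, Option.map_map, Prod.map_comp_map]
  rw [show Bool.not ∘ Bool.not = id by funext b; simp]
  simp

theorem exchangeBlocks_eq_some {k n : ℕ} [NeZero n] {j i : Fin n} {b : Bool} {c : Fin k}
    {f : Fin n → Option (Bool × Fin k)} :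
    exchangeBlocks j f i = some (b, c) ↔ f (Equiv.swap 0 j i) = some (!b, c) := by
  rw [exchangeBlocks, Option.map_eq_some_iff]
  constructor
  · rintro ⟨⟨a, d⟩, h1, h2⟩
    simp only [Prod.map_apply, id, Prod.mk.injEq] at h2
    rw [h1, ← h2.1, ← h2.2]
    simp
  · intro h
    exact ⟨_, h, by simp⟩

theorem card_exchangeBlocks {k n : ℕ} [NeZero n] (j : Fin n) (b : Bool) (c : Fin k)
    (f : Fin n → Option (Bool × Fin k)) :
    (Finset.univ.filter fun i => exchangeBlocks j f i = some (b, c)).card =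
      (Finset.univ.filter fun i => f i = some (!b, c)).card := by
  simp only [exchangeBlocks_eq_some]
  refine Finset.card_bij (fun i _ => Equiv.swap 0 j i) ?_ ?_ ?_
  · intro i hi
    simpa using hi
  · intro a _ b _ h
    exact (Equiv.swap 0 j).injective h
  · intro i hi
    exact ⟨Equiv.swap 0 j i, by simpa using hi, by simp⟩

theorem exchangeBlocks_mem {k n : ℕ} [NeZero n] {U : Finset (Fin n)} {u v : Fin k → ℕ}
    {f : Fin n → Option (Bool × Fin k)} {j : Fin n} (hf : f ∈ blockColourings k U u v)
    (hj : ∃ c, f j = some (false, c)) :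
    exchangeBlocks j f ∈ blockColourings k U v u ∧
      ∃ c, exchangeBlocks j f j = some (false, c) := by
  rw [mem_blockColourings] at hf ⊢
  obtain ⟨hU, ⟨c0, h0⟩, hu, hv⟩ := hf
  obtain ⟨cj, hj⟩ := hj
  refine ⟨⟨fun i => ?_, ⟨cj, ?_⟩, fun c => ?_, fun c => ?_⟩, c0, ?_⟩
  · have h0U : (0 : Fin n) ∉ U := fun h => by simp [(hU 0).2 h] at h0
    have hjU : j ∉ U := fun h => by simp [(hU j).2 h] at hj
    rw [exchangeBlocks, Option.map_eq_none_iff, hU]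
    rcases eq_or_ne i 0 with rfl | hi0
    · simp [h0U, hjU]
    rcases eq_or_ne i j with rfl | hij
    · simp [h0U, hjU]
    rw [Equiv.swap_apply_of_ne_of_ne hi0 hij]
  · rw [exchangeBlocks_eq_some]; simpa using hj
  · rw [card_exchangeBlocks]; exact hv c
  · rw [card_exchangeBlocks]; exact hu c
  · rw [exchangeBlocks_eq_some]; simpa using h0

/-- Both sides count colourings with a marked car on side `false`. The exchange along the marked car
is an involution, and it leaves the mark on side `false`, since that car takes over the old colour
of car 1 with its side flipped. -/
theorem card_blockColourings_mul_sum {k n : ℕ} [NeZero n] (U : Finset (Fin n))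
    (u v : Fin k → ℕ) :
    (blockColourings k U u v).card * ∑ c, u c = (blockColourings k U v u).card * ∑ c, v c := by
  have h : ∀ u v : Fin k → ℕ, (blockColourings k U u v).card * ∑ c, u c =
      ((blockColourings k U u v).sigma fun f =>
        Finset.univ.filter fun i => ∃ c, f i = some (false, c)).card := by
    intro u v
    rw [Finset.card_sigma, ← smul_eq_mul, ← Finset.sum_const]
    refine Finset.sum_congr rfl fun f hf => Eq.symm ?_
    rw [card_filter_exists_eq_sum]
    exact Finset.sum_congr rfl fun c _ => (mem_blockColourings.1 hf).2.2.1 c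
  rw [h, h]
  refine Finset.card_nbij' (fun x => ⟨exchangeBlocks x.2 x.1, x.2⟩)
    (fun x => ⟨exchangeBlocks x.2 x.1, x.2⟩) ?_ ?_ ?_ ?_
  · rintro ⟨f, j⟩ hx
    simp only [Finset.coe_sigma, Set.mem_sigma_iff, Finset.mem_coe, Finset.mem_filter,
      Finset.mem_univ, true_and] at hx ⊢
    exact exchangeBlocks_mem hx.1 hx.2
  · rintro ⟨f, j⟩ hx
    simp only [Finset.coe_sigma, Set.mem_sigma_iff, Finset.mem_coe, Finset.mem_filter,
      Finset.mem_univ, true_and] at hx ⊢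
    exact exchangeBlocks_mem hx.1 hx.2
  · rintro ⟨f, j⟩ _
    simp [exchangeBlocks_exchangeBlocks]
  · rintro ⟨f, j⟩ _
    simp [exchangeBlocks_exchangeBlocks]

/-! ### The parking condition in terms of blocks -/

theorem mem_blockVector {k n : ℕ} {π : Fin n → ℕ} {i : ℕ} {c : Fin k} {j : Fin n}
    (hj : 1 ≤ π j) :
    j ∈ blockVector k π (i + 1) c ↔ (π j - 1) / k = i ∧ (π j - 1) % k = c := by
  have hk : 0 < k := c.pos
  rw [blockVector, carsPreferring, Finset.mem_filter, Nat.succ_mul, Nat.add_sub_cancel,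
    Nat.div_mod_unique hk]
  have := c.is_lt
  rw [mul_comm k i]
  simp only [Finset.mem_univ, true_and]
  omega

theorem leadingBlock_eq {k n : ℕ} [NeZero n] {π : Fin n → ℕ} (hk : 0 < k) (h0 : 1 ≤ π 0) :
    leadingBlock k π = (π 0 - 1) / k + 1 := by
  rw [leadingBlock, Nat.ceilDiv_eq_add_pred_div, show π 0 + k - 1 = π 0 - 1 + k by omega,
    Nat.add_div_right _ hk]

theorem sum_card_blockVector {k n : ℕ} {π : Fin n → ℕ} (hk : 0 < k) (hπ : ∀ j, 1 ≤ π j)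
    (i : ℕ) : ∑ c, (blockVector k π (i + 1) c).card =
      (Finset.univ.filter fun j => (π j - 1) / k = i).card := by
  rw [← Finset.card_biUnion]
  · congr 1
    ext j
    simp only [Finset.mem_biUnion, Finset.mem_univ, true_and, mem_blockVector (hπ j),
      Finset.mem_filter]
    exact ⟨fun ⟨_, h, _⟩ => h, fun h => ⟨⟨(π j - 1) % k, Nat.mod_lt _ hk⟩, h, rfl⟩⟩
  · intro c _ d _ hcd
    rw [Function.onFun, Finset.disjoint_left]
    intro j h1 h2
    rw [mem_blockVector (hπ j)] at h1 h2
    exact hcd (Fin.ext (h1.2.symm.trans h2.2))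

/-- A sorted entry with index `t` is at most `(t + 1) * k` exactly when more than `t` entries are,
that is, when more than `t` cars prefer the first `t + 1` blocks. -/
theorem isABParkingFunction_iff {k n : ℕ} {π : Fin n → ℕ} (hk : 0 < k) :
    IsABParkingFunction k k π ↔ (∀ j, 1 ≤ π j) ∧
      ∀ t, t < n → t < (Finset.univ.filter fun j => (π j - 1) / k ≤ t).card := by
  refine and_congr_right fun hπ => ?_
  have key : ∀ i : Fin n, increasingRearrangement π i ≤ k + (i : ℕ) * k ↔
      (i : ℕ) < (Finset.univ.filter fun j => (π j - 1) / k ≤ i).card := by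
    intro i
    rw [← Tuple.lt_card_le_iff_apply_le_of_monotone (f := increasingRearrangement π)
      (Tuple.monotone_sort π)]
    have : (Finset.univ.filter fun j => increasingRearrangement π j ≤ k + (i : ℕ) * k).card =
        (Finset.univ.filter fun j => (π j - 1) / k ≤ i).card := by
      refine Finset.card_bij (fun j _ => Tuple.sort π j) ?_ ?_ ?_
      · intro j hj
        simp only [Finset.mem_filter, Finset.mem_univ, true_and] at hj ⊢
        rw [increasingRearrangement, Function.comp_apply] at hj
        have := hπ (Tuple.sort π j)
        rw [Nat.div_le_iff_le_mul_add_pred hk, mul_comm]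
        omega
      · intro a _ b _ h
        exact (Tuple.sort π).injective h
      · intro j hj
        refine ⟨(Tuple.sort π).symm j, ?_, by simp⟩
        simp only [Finset.mem_filter, Finset.mem_univ, true_and] at hj ⊢
        rw [increasingRearrangement, Function.comp_apply, Equiv.apply_symm_apply]
        rw [Nat.div_le_iff_le_mul_add_pred hk, mul_comm] at hj
        have := hπ j
        omega
    rw [← this]
  exact ⟨fun h t ht => (key ⟨t, ht⟩).1 (h ⟨t, ht⟩), fun h i => (key i).2 (h i i.is_lt)⟩

theorem card_filter_le_eq_sum {N n t : ℕ} (ht : t ≤ N) (b : Fin n → ℕ) :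
    (Finset.univ.filter fun j => b j ≤ t).card = (Finset.univ.filter fun j => b j = 0).card +
      ∑ i : Fin N, if (i : ℕ) < t then (Finset.univ.filter fun j => b j = i + 1).card else 0 := by
  rw [Finset.card_eq_sum_card_fiberwise (f := b) (t := Finset.range (t + 1)),
    Finset.sum_range_succ', add_comm,
    Fin.sum_univ_eq_sum_range
      (fun i => if i < t then (Finset.univ.filter fun j => b j = i + 1).card else 0) N,
    ← Finset.sum_filter]
  · congr 1
    · congr 1
      ext j
      simp only [Finset.mem_filter, Finset.mem_univ, true_and]
      omega
    · refine Finset.sum_congr ?_ fun i hi => ?_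
      · ext i
        simp only [Finset.mem_filter, Finset.mem_range]
        omega
      · congr 1
        ext j
        simp only [Finset.mem_filter, Finset.mem_univ, true_and, Finset.mem_range] at hi ⊢
        omega
  · intro j hj
    simp only [Finset.coe_filter, Finset.mem_univ, true_and, Set.mem_ofPred_eq, Finset.coe_range,
      Set.mem_Iio] at hj ⊢
    omega

/-- The parking condition in terms of the contents of the blocks. -/
theorem isABParkingFunction_iff_ballot {k N : ℕ} {π : Fin (N + 1) → ℕ} (hk : 0 < k) :
    IsABParkingFunction k k π ↔ (∀ j, 1 ≤ π j) ∧
      ∀ t, t ≤ N → t < ∑ c, (blockVector k π 1 c).card +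
        ∑ i : Fin N, if (i : ℕ) < t then ∑ c, (blockVector k π (i + 2) c).card else 0 := by
  rw [isABParkingFunction_iff hk]
  refine and_congr_right fun hπ => ?_
  have h1 := sum_card_blockVector hk hπ 0
  have h2 : ∀ i : Fin N, ∑ c, (blockVector k π (i + 2) c).card = _ :=
    fun i => sum_card_blockVector hk hπ (i + 1)
  rw [zero_add] at h1
  simp only [h1, h2, Nat.lt_succ_iff]
  refine forall₂_congr fun t ht => ?_
  rw [card_filter_le_eq_sum ht]

theorem mem_otherBlockVectors {k n : ℕ} [NeZero n] {π : Fin n → ℕ} (hk : 0 < k)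
    (h0 : 1 ≤ π 0) {x : Fin k → Finset (Fin n)} : x ∈ otherBlockVectors k π ↔
      x ≠ (fun _ => ∅) ∧ ∃ m, m < n ∧ m ≠ 0 ∧ m ≠ (π 0 - 1) / k ∧ blockVector k π (m + 1) = x := by
  rw [otherBlockVectors, leadingBlock_eq hk h0, Finset.mem_image]
  simp only [Finset.mem_filter, Finset.mem_Icc]
  constructor
  · rintro ⟨i, ⟨⟨h1, h2⟩, h3, h4, h5⟩, rfl⟩
    obtain ⟨m, rfl⟩ := Nat.exists_eq_add_of_le' h1
    exact ⟨h5, m, by omega, by omega, by omega, rfl⟩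
  · rintro ⟨hx, m, h1, h2, h3, rfl⟩
    exact ⟨m + 1, ⟨⟨by omega, by omega⟩, by omega, by omega, hx⟩, rfl⟩

/-! ### The colouring of a parking function -/

/-- All the cars in the entries of the vectors in `𝒪`. -/
def unionOfEntries {k n : ℕ} (𝒪 : Finset (Fin k → Finset (Fin n))) : Finset (Fin n) :=
  (𝒪 ×ˢ Finset.univ).biUnion fun z => z.1 z.2

theorem mem_unionOfEntries {k n : ℕ} {𝒪 : Finset (Fin k → Finset (Fin n))} {j : Fin n} :
    j ∈ unionOfEntries 𝒪 ↔ ∃ x ∈ 𝒪, ∃ c, j ∈ x c := by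
  simp [unionOfEntries]

/-- The vector of the sets of cars on one side of a colouring. -/
def colouringSide {k n : ℕ} (f : Fin n → Option (Bool × Fin k)) (b : Bool) :
    Fin k → Finset (Fin n) :=
  fun c => Finset.univ.filter fun i => f i = some (b, c)

theorem mem_colouringSide {k n : ℕ} {f : Fin n → Option (Bool × Fin k)} {b : Bool} {c : Fin k}
    {i : Fin n} : i ∈ colouringSide f b c ↔ f i = some (b, c) := by
  simp [colouringSide]

/-- The colouring of the cars outside `U` by block (first or other) and by position within the
block. -/
def blockColouring {k n : ℕ} (hk : 0 < k) (U : Finset (Fin n)) (π : Fin n → ℕ) :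
    Fin n → Option (Bool × Fin k) :=
  fun i => if i ∈ U then none else
    some (decide ((π i - 1) / k ≠ 0), ⟨(π i - 1) % k, Nat.mod_lt _ hk⟩)

theorem blockColouring_eq_some {k n : ℕ} {hk : 0 < k} {U : Finset (Fin n)} {π : Fin n → ℕ}
    {i : Fin n} {b : Bool} {c : Fin k} : blockColouring hk U π i = some (b, c) ↔
      i ∉ U ∧ ((π i - 1) / k ≠ 0 ↔ b = true) ∧ (π i - 1) % k = c := by
  rw [blockColouring]
  split_ifs with h
  · simp [h]
  · simp only [Option.some.injEq, Prod.mk.injEq, h, not_false_eq_true, true_and, Fin.ext_iff]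
    refine and_congr_left' ?_
    cases b <;> simp

theorem mem_colouringSide_blockColouring {k n : ℕ} {hk : 0 < k} {U : Finset (Fin n)}
    {π : Fin n → ℕ} {i : Fin n} {b : Bool} {c : Fin k} :
    i ∈ colouringSide (blockColouring hk U π) b c ↔
      i ∉ U ∧ ((π i - 1) / k ≠ 0 ↔ b = true) ∧ (π i - 1) % k = c := by
  rw [mem_colouringSide, blockColouring_eq_some]

/-- The parking condition at `t = n - 1` puts all `n` cars in the first `n` blocks. -/
theorem block_lt_of_isABParkingFunction {k n : ℕ} {π : Fin n → ℕ} (hk : 0 < k)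
    (h : IsABParkingFunction k k π) (j : Fin n) : (π j - 1) / k < n := by
  have hn : n - 1 < n := by have := j.pos; omega
  have h1 := ((isABParkingFunction_iff hk).1 h).2 (n - 1) hn
  have h2 : (Finset.univ.filter fun j => (π j - 1) / k ≤ n - 1) = Finset.univ := by
    refine Finset.eq_univ_of_card _ (le_antisymm (Finset.card_le_univ _) ?_)
    rw [Fintype.card_fin]
    omega
  have h3 := Finset.mem_univ j
  rw [← h2, Finset.mem_filter] at h3
  omega

theorem mem_unionOfEntries_otherBlockVectors {k n : ℕ} [NeZero n] {π : Fin n → ℕ} (hk : 0 < k)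
    (h : IsABParkingFunction k k π) (j : Fin n) : j ∈ unionOfEntries (otherBlockVectors k π) ↔
      (π j - 1) / k ≠ 0 ∧ (π j - 1) / k ≠ (π 0 - 1) / k := by
  simp only [mem_unionOfEntries, mem_otherBlockVectors hk (h.1 0)]
  constructor
  · rintro ⟨x, ⟨_, m, -, h1, h2, rfl⟩, c, hc⟩
    rw [mem_blockVector (h.1 j)] at hc
    exact ⟨hc.1 ▸ h1, hc.1 ▸ h2⟩
  · rintro ⟨h1, h2⟩
    have hmem : j ∈ blockVector k π ((π j - 1) / k + 1) ⟨(π j - 1) % k, Nat.mod_lt _ hk⟩ :=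
      (mem_blockVector (h.1 j)).2 ⟨rfl, rfl⟩
    refine ⟨_, ⟨fun he => ?_, _, block_lt_of_isABParkingFunction hk h j, h1, h2, rfl⟩, _, hmem⟩
    rw [he] at hmem
    simp at hmem

theorem colouringSide_false_blockColouring {k n : ℕ} [NeZero n] {π : Fin n → ℕ} (hk : 0 < k)
    (h : IsABParkingFunction k k π) :
    colouringSide (blockColouring hk (unionOfEntries (otherBlockVectors k π)) π) false =
      blockVector k π 1 := by
  funext c
  ext i
  rw [mem_colouringSide_blockColouring, mem_unionOfEntries_otherBlockVectors hk h,
    mem_blockVector (i := 0) (h.1 i)]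
  simp only [Bool.false_eq_true, iff_false, not_not]
  tauto

theorem colouringSide_true_blockColouring {k n : ℕ} [NeZero n] {π : Fin n → ℕ} (hk : 0 < k)
    (h : IsABParkingFunction k k π) (h0 : (π 0 - 1) / k ≠ 0) :
    colouringSide (blockColouring hk (unionOfEntries (otherBlockVectors k π)) π) true =
      blockVector k π ((π 0 - 1) / k + 1) := by
  funext c
  ext i
  rw [mem_colouringSide_blockColouring, mem_unionOfEntries_otherBlockVectors hk h,
    mem_blockVector (h.1 i)]
  simp only [iff_true]
  constructor
  · tauto
  · rintro ⟨h1, h2⟩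
    rw [h1]
    tauto

theorem blockColouring_mem {k n : ℕ} [NeZero n] {π : Fin n → ℕ} (hk : 0 < k)
    (h : IsABParkingFunction k k π) (h0 : (π 0 - 1) / k ≠ 0) :
    blockColouring hk (unionOfEntries (otherBlockVectors k π)) π ∈
      blockColourings k (unionOfEntries (otherBlockVectors k π)) (blockCounts k π 1)
        (blockCounts k π (leadingBlock k π)) := by
  have hF := colouringSide_false_blockColouring hk h
  have hT := colouringSide_true_blockColouring hk h h0
  rw [mem_blockColourings, leadingBlock_eq hk (h.1 0)]
  refine ⟨fun i => ?_, ⟨⟨(π 0 - 1) % k, Nat.mod_lt _ hk⟩, ?_⟩, fun c => ?_, fun c => ?_⟩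
  · rw [blockColouring]
    split_ifs with hi <;> simp [hi]
  · rw [blockColouring_eq_some, mem_unionOfEntries_otherBlockVectors hk h]
    simp [h0]
  · exact congrArg Finset.card (congrFun hF c)
  · exact congrArg Finset.card (congrFun hT c)

/-- Every car is in the first block, in the leading block or, by disjointness, in exactly one entry
of `𝒪`. This is the total required by the cycle lemma. -/
theorem sum_add_sum_insert_eq {k n : ℕ} [NeZero n] {𝒪 : Finset (Fin k → Finset (Fin n))}
    (h_disjoint : ∀ S ∈ 𝒪, ∀ T ∈ 𝒪, ∀ c d : Fin k, (S, c) ≠ (T, d) → Disjoint (S c) (T d))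
    {u v : Fin k → ℕ} {f : Fin n → Option (Bool × Fin k)}
    (hf : f ∈ blockColourings k (unionOfEntries 𝒪) u v) (hT : colouringSide f true ∉ 𝒪) :
    ∑ c, u c + ∑ x ∈ insert (colouringSide f true) 𝒪, ∑ c, (x c).card = n := by
  rw [mem_blockColourings] at hf
  obtain ⟨hU, -, hu, hv⟩ := hf
  have h1 : ∑ x ∈ 𝒪, ∑ c, (x c).card = (Finset.univ.filter fun i => f i = none).card := by
    simp only [hU, Finset.filter_univ_mem]
    rw [unionOfEntries, Finset.card_biUnion, Finset.sum_product]
    rintro ⟨x, c⟩ hx ⟨y, d⟩ hy hne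
    simp only [Finset.coe_product, Set.mem_prod, Finset.mem_coe] at hx hy
    exact h_disjoint x hx.1 y hy.1 c d hne
  have h2 : n = ∑ o : Option (Bool × Fin k), (Finset.univ.filter fun i => f i = o).card := by
    rw [← Finset.card_eq_sum_card_fiberwise (fun _ _ => Finset.mem_coe.2 (Finset.mem_univ _)),
      Finset.card_univ, Fintype.card_fin]
  rw [Fintype.sum_option, Fintype.sum_prod_type, Fintype.sum_bool] at h2
  simp only [hu, hv] at h2
  have h3 : ∑ c, (colouringSide f true c).card = ∑ c, v c := Finset.sum_congr rfl fun c _ => hv c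
  rw [Finset.sum_insert hT, h1, h3]
  omega

/-! ### Parking functions as colourings with ballot words -/

theorem leadingBlock_ne_of_blockCounts_ne {k n : ℕ} [NeZero n] {π : Fin n → ℕ} (hk : 0 < k)
    (h0 : 1 ≤ π 0) (h : blockCounts k π 1 ≠ blockCounts k π (leadingBlock k π)) :
    (π 0 - 1) / k ≠ 0 := by
  intro h1
  rw [leadingBlock_eq hk h0, h1] at h
  exact h rfl

theorem eq_of_mem_of_mem {k n : ℕ} {𝒪 : Finset (Fin k → Finset (Fin n))}
    (h_disjoint : ∀ S ∈ 𝒪, ∀ T ∈ 𝒪, ∀ c d : Fin k, (S, c) ≠ (T, d) → Disjoint (S c) (T d))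
    {f : Fin n → Option (Bool × Fin k)} (hU : ∀ i, f i = none ↔ i ∈ unionOfEntries 𝒪)
    {x y : Fin k → Finset (Fin n)} (hx : x ∈ insert (colouringSide f true) 𝒪)
    (hy : y ∈ insert (colouringSide f true) 𝒪) {c d : Fin k} {j : Fin n} (hjx : j ∈ x c)
    (hjy : j ∈ y d) : x = y ∧ c = d := by
  have key : ∀ z ∈ 𝒪, ∀ b, j ∈ z b → ∀ a, j ∉ colouringSide f true a := by
    intro z hz b hb a ha
    rw [mem_colouringSide, Option.eq_some_iff_get_eq] at ha
    have := (hU j).2 (mem_unionOfEntries.2 ⟨z, hz, b, hb⟩)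
    simp [this] at ha
  rw [Finset.mem_insert] at hx hy
  rcases hx with rfl | hx <;> rcases hy with rfl | hy
  · rw [mem_colouringSide] at hjx hjy
    rw [hjx] at hjy
    simpa using hjy
  · exact absurd hjx (key y hy d hjy c)
  · exact absurd hjy (key x hx c hjx d)
  · by_contra hne
    have := h_disjoint x hx y hy c d fun he => hne (by simpa using he)
    exact Finset.disjoint_left.1 this hjx hjy

theorem notMem_of_mem_side {k n : ℕ} {𝒪 : Finset (Fin k → Finset (Fin n))}
    {f : Fin n → Option (Bool × Fin k)} (hU : ∀ i, f i = none ↔ i ∈ unionOfEntries 𝒪)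
    {x : Fin k → Finset (Fin n)} (hx : x ∈ insert (colouringSide f true) 𝒪) {c d : Fin k}
    {j : Fin n} (hj : j ∈ colouringSide f false c) : j ∉ x d := by
  intro hjx
  rw [mem_colouringSide] at hj
  rw [Finset.mem_insert] at hx
  rcases hx with rfl | hx
  · rw [mem_colouringSide, hj] at hjx
    simp at hjx
  · have := (hU j).2 (mem_unionOfEntries.2 ⟨x, hx, d, hjx⟩)
    simp [this] at hj

/-- The contents of the blocks after the first one form a ballot word. -/
theorem blockVector_mem_ballotWords {k N : ℕ} {π : Fin (N + 1) → ℕ} (hk : 0 < k)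
    (h : IsABParkingFunction k k π) (h0 : (π 0 - 1) / k ≠ 0) :
    (fun i : Fin N => blockVector k π (i + 2)) ∈
      ballotWords (fun _ => ∅) (fun x => ∑ c, (x c).card) N (∑ c, blockCounts k π 1 c)
        (insert (blockVector k π ((π 0 - 1) / k + 1)) (otherBlockVectors k π)) := by
  rw [mem_ballotWords, sum_ite_eq_ite_mem_iff]
  refine ⟨⟨fun y hy => ?_, fun i i' hii hi => ?_⟩, ((isABParkingFunction_iff_ballot hk).1 h).2⟩
  · rw [Finset.mem_insert, mem_otherBlockVectors hk (h.1 0)]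
    constructor
    · rintro (rfl | ⟨-, m, h1, h2, -, rfl⟩)
      · have := block_lt_of_isABParkingFunction hk h 0
        obtain ⟨m, hm⟩ := Nat.exists_eq_succ_of_ne_zero h0
        exact ⟨⟨m, by omega⟩, by rw [hm]⟩
      · obtain ⟨m, rfl⟩ := Nat.exists_eq_succ_of_ne_zero h2
        exact ⟨⟨m, by omega⟩, rfl⟩
    · rintro ⟨i, rfl⟩
      by_cases hi : (i : ℕ) + 1 = (π 0 - 1) / k
      · left
        rw [← hi]
      · exact Or.inr ⟨hy, i + 1, by omega, by omega, hi, rfl⟩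
  · have : ∃ c, (blockVector k π (i + 2) c).Nonempty := by
      by_contra! hne
      exact hi (funext hne)
    obtain ⟨c, j, hj⟩ := this
    have hj' := hj
    rw [show blockVector k π (i + 2) = _ from hii] at hj'
    have h1 := (mem_blockVector (i := i + 1) (h.1 j)).1 hj
    have h2 := (mem_blockVector (i := i' + 1) (h.1 j)).1 hj'
    exact Fin.ext (by omega)

theorem eq_of_forall_blockVector_eq {k N : ℕ} {π π' : Fin (N + 1) → ℕ} (hk : 0 < k)
    (h : IsABParkingFunction k k π) (h' : IsABParkingFunction k k π')
    (h1 : blockVector k π 1 = blockVector k π' 1)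
    (hw : ∀ i : Fin N, blockVector k π (i + 2) = blockVector k π' (i + 2)) : π = π' := by
  funext j
  have hb : ∀ m, m < N + 1 → blockVector k π (m + 1) = blockVector k π' (m + 1) := by
    intro m hm
    cases m with
    | zero => exact h1
    | succ m => exact hw ⟨m, by omega⟩
  have hj : j ∈ blockVector k π ((π j - 1) / k + 1) ⟨(π j - 1) % k, Nat.mod_lt _ hk⟩ :=
    (mem_blockVector (h.1 j)).2 ⟨rfl, rfl⟩
  rw [hb _ (block_lt_of_isABParkingFunction hk h j), mem_blockVector (h'.1 j)] at hj
  have e1 := Nat.div_add_mod (π j - 1) k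
  have e2 := Nat.div_add_mod (π' j - 1) k
  rw [hj.1, hj.2] at e2
  have := h.1 j
  have := h'.1 j
  simp only at e2
  omega

theorem exists_blockVector_eq {k n : ℕ} (hk : 0 < k) (W : ℕ → Fin k → Finset (Fin n))
    (hex : ∀ j, ∃ i, i < n ∧ ∃ c, j ∈ W i c)
    (huniq : ∀ j i i' c c', i < n → i' < n → j ∈ W i c → j ∈ W i' c' → i = i' ∧ c = c') :
    ∃ π : Fin n → ℕ, (∀ j, 1 ≤ π j) ∧ ∀ i, i < n → blockVector k π (i + 1) = W i := by
  choose b hb c hc using hex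
  have h1 : ∀ j, 1 ≤ b j * k + c j + 1 := fun j => by omega
  refine ⟨fun j => b j * k + c j + 1, h1, fun i hi => ?_⟩
  funext d
  ext j
  rw [mem_blockVector (h1 j), Nat.add_sub_cancel, Nat.mul_comm, Nat.mul_add_div hk,
    Nat.mul_add_mod, Nat.div_eq_of_lt (c j).is_lt, Nat.mod_eq_of_lt (c j).is_lt, add_zero]
  constructor
  · rintro ⟨rfl, h2⟩
    rw [← Fin.ext h2]
    exact hc j
  · intro hj
    obtain ⟨h2, h3⟩ := huniq j _ _ _ _ (hb j) hi (hc j) hj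
    exact ⟨h2, congrArg _ h3⟩

/-- The side `false` fills the first block and the letters of `w` fill the others. Each car then
lies in exactly one entry, which determines its preference. -/
theorem exists_parkingFunction_of_mem_ballotWords {k N : ℕ} (hk : 0 < k)
    {𝒪 : Finset (Fin k → Finset (Fin (N + 1)))}
    (h_nonempty : ∀ S ∈ 𝒪, S ≠ fun _ => ∅)
    (h_disjoint : ∀ S ∈ 𝒪, ∀ T ∈ 𝒪, ∀ c d : Fin k, (S, c) ≠ (T, d) → Disjoint (S c) (T d))
    {u v : Fin k → ℕ} {f : Fin (N + 1) → Option (Bool × Fin k)}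
    (hf : f ∈ blockColourings k (unionOfEntries 𝒪) u v) (hT : colouringSide f true ∉ 𝒪)
    {w : Fin N → Fin k → Finset (Fin (N + 1))}
    (hw : w ∈ ballotWords (fun _ => ∅) (fun x => ∑ c, (x c).card) N (∑ c, u c)
      (insert (colouringSide f true) 𝒪)) :
    ∃ π : Fin (N + 1) → ℕ, IsABParkingFunction k k π ∧ otherBlockVectors k π = 𝒪 ∧
      (π 0 - 1) / k ≠ 0 ∧
      blockVector k π 1 = colouringSide f false ∧
      blockVector k π ((π 0 - 1) / k + 1) = colouringSide f true ∧
      ∀ i : Fin N, blockVector k π (i + 2) = w i := by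
  rw [mem_ballotWords, sum_ite_eq_ite_mem_iff] at hw
  obtain ⟨⟨hX, hinj⟩, hballot⟩ := hw
  rw [mem_blockColourings] at hf
  obtain ⟨hU, ⟨c₀, h₀⟩, hu, -⟩ := hf
  -- The leading vector contains car 1, so it is not the blank letter and occurs in `w`.
  have hTe : colouringSide f true ≠ fun _ => ∅ := fun he => by
    have := mem_colouringSide.2 h₀
    rw [he] at this
    simp at this
  obtain ⟨i₀, hi₀⟩ := (hX _ hTe).1 (Finset.mem_insert_self _ _)
  have hwX : ∀ i c j, j ∈ w i c → w i ∈ insert (colouringSide f true) 𝒪 := by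
    intro i c j hj
    refine (hX _ fun he => ?_).2 ⟨i, rfl⟩
    rw [he] at hj
    simp at hj
  obtain ⟨W, hW0, hWs⟩ : ∃ W : ℕ → Fin k → Finset (Fin (N + 1)),
      W 0 = colouringSide f false ∧ ∀ i : Fin N, W (i + 1) = w i :=
    -- The value `∅` beyond the last block is never used.
    ⟨fun i => Nat.casesOn i (colouringSide f false) fun i => if h : i < N then w ⟨i, h⟩ else
      fun _ => ∅, rfl, fun i => by simp⟩
  have hWs' : ∀ i, i < N + 1 → i ≠ 0 → ∃ i' : Fin N, i = i' + 1 ∧ W i = w i' := by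
    intro i hi hi0
    obtain ⟨m, rfl⟩ := Nat.exists_eq_succ_of_ne_zero hi0
    exact ⟨⟨m, by omega⟩, rfl, hWs ⟨m, by omega⟩⟩
  obtain ⟨π, hpos, hπ⟩ := exists_blockVector_eq hk W
    (by
      intro j
      rcases hfj : f j with _ | ⟨_ | _, c⟩
      · obtain ⟨x, hx, c, hc⟩ := mem_unionOfEntries.1 ((hU j).1 hfj)
        obtain ⟨i, hi⟩ := (hX x (h_nonempty x hx)).1 (Finset.mem_insert_of_mem hx)
        exact ⟨i + 1, by omega, c, by rwa [hWs, hi]⟩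
      · exact ⟨0, by omega, c, by rwa [hW0, mem_colouringSide]⟩
      · exact ⟨i₀ + 1, by omega, c, by rwa [hWs, hi₀, mem_colouringSide]⟩)
    (by
      intro j i i' c c' hi hi' hj hj'
      by_cases h : i = 0 <;> by_cases h' : i' = 0
      · subst h h'
        rw [hW0, mem_colouringSide] at hj hj'
        rw [hj] at hj'
        simpa using hj'
      · obtain ⟨l, -, hl⟩ := hWs' i' hi' h'
        rw [h, hW0] at hj
        rw [hl] at hj'
        exact absurd hj' (notMem_of_mem_side hU (hwX _ _ _ hj') hj)
      · obtain ⟨l, -, hl⟩ := hWs' i hi h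
        rw [h', hW0] at hj'
        rw [hl] at hj
        exact absurd hj (notMem_of_mem_side hU (hwX _ _ _ hj) hj')
      · obtain ⟨l, rfl, hl⟩ := hWs' i hi h
        obtain ⟨l', rfl, hl'⟩ := hWs' i' hi' h'
        rw [hl] at hj
        rw [hl'] at hj'
        obtain ⟨h1, h2⟩ := eq_of_mem_of_mem h_disjoint hU (hwX _ _ _ hj) (hwX _ _ _ hj') hj hj'
        refine ⟨?_, h2⟩
        rw [hinj l l' h1]
        intro he
        rw [he] at hj
        simp at hj)
  have hπ1 : blockVector k π 1 = colouringSide f false := (hπ 0 (by omega)).trans hW0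
  have hπw : ∀ i : Fin N, blockVector k π (i + 2) = w i :=
    fun i => (hπ (i + 1) (by omega)).trans (hWs i)
  have hb0 : (π 0 - 1) / k = i₀ + 1 := by
    have : (0 : Fin (N + 1)) ∈ blockVector k π (i₀ + 1 + 1) c₀ := by
      rwa [hπ _ (by omega), hWs, hi₀, mem_colouringSide]
    exact ((mem_blockVector (hpos 0)).1 this).1
  refine ⟨π, ?_, ?_, by omega, hπ1, ?_, hπw⟩
  · rw [isABParkingFunction_iff_ballot hk]
    refine ⟨hpos, fun t ht => ?_⟩
    have h1 : ∑ c, (blockVector k π 1 c).card = ∑ c, u c :=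
      Finset.sum_congr rfl fun c _ => by rw [hπ1]; exact hu c
    simp only [h1, hπw]
    exact hballot t ht
  · ext x
    rw [mem_otherBlockVectors hk (hpos 0), hb0]
    constructor
    · rintro ⟨hx, m, h1, h2, h3, rfl⟩
      obtain ⟨i, rfl, hi⟩ := hWs' m h1 h2
      rw [hπ _ h1, hi] at hx ⊢
      refine Finset.mem_of_mem_insert_of_ne ((hX _ hx).2 ⟨i, rfl⟩) fun he => h3 ?_
      rw [hinj i i₀ (he.trans hi₀.symm) hx]
    · intro hx
      obtain ⟨i, rfl⟩ := (hX x (h_nonempty x hx)).1 (Finset.mem_insert_of_mem hx)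
      refine ⟨h_nonempty _ hx, i + 1, by omega, by omega, fun he => hT ?_, hπw i⟩
      rw [← hi₀]
      rwa [← Fin.ext (Nat.succ_injective he)]
  · rw [hb0, ← hi₀]
    exact hπw i₀

theorem colouring_ext {k n : ℕ} {f g : Fin n → Option (Bool × Fin k)}
    (h : ∀ b, colouringSide f b = colouringSide g b) : f = g := by
  funext i
  refine Option.ext ?_
  rintro ⟨b, c⟩
  rw [← mem_colouringSide, ← mem_colouringSide, h]

/-- Once `𝒪` and the colouring are fixed, only the arrangement of the later blocks is free. -/
theorem card_filter_blockColouring {k N : ℕ} (hk : 0 < k)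
    {𝒪 : Finset (Fin k → Finset (Fin (N + 1)))}
    (h_nonempty : ∀ S ∈ 𝒪, S ≠ fun _ => ∅)
    (h_disjoint : ∀ S ∈ 𝒪, ∀ T ∈ 𝒪, ∀ c d : Fin k, (S, c) ≠ (T, d) → Disjoint (S c) (T d))
    {u v : Fin k → ℕ} (huv : u ≠ v) {f : Fin (N + 1) → Option (Bool × Fin k)}
    (hf : f ∈ blockColourings k (unionOfEntries 𝒪) u v) (hT : colouringSide f true ∉ 𝒪) :
    ((((abParkingFunctions k k (N + 1)).filter fun π => otherBlockVectors k π = 𝒪).filter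
      fun π => blockCounts k π 1 = u ∧ blockCounts k π (leadingBlock k π) = v).filter
        fun π => blockColouring hk (unionOfEntries 𝒪) π = f).card =
    (ballotWords (fun _ => ∅) (fun x => ∑ c, (x c).card) N (∑ c, u c)
      (insert (colouringSide f true) 𝒪)).card := by
  have hmem : ∀ π, π ∈ (((abParkingFunctions k k (N + 1)).filter
      fun π => otherBlockVectors k π = 𝒪).filter
        fun π => blockCounts k π 1 = u ∧ blockCounts k π (leadingBlock k π) = v).filter
          (fun π => blockColouring hk (unionOfEntries 𝒪) π = f) ↔
      IsABParkingFunction k k π ∧ otherBlockVectors k π = 𝒪 ∧ blockCounts k π 1 = u ∧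
        blockCounts k π (leadingBlock k π) = v ∧
          blockColouring hk (unionOfEntries 𝒪) π = f := by
    intro π
    simp only [Finset.mem_filter, abParkingFunctions, Set.Finite.mem_toFinset, Set.mem_ofPred_eq,
      and_assoc]
  refine Finset.card_bij (fun π _ i => blockVector k π (i + 2)) ?_ ?_ ?_
  · intro π hπ
    obtain ⟨hpf, rfl, rfl, rfl, rfl⟩ := (hmem π).1 hπ
    have h0 := leadingBlock_ne_of_blockCounts_ne hk (hpf.1 0) huv
    rw [colouringSide_true_blockColouring hk hpf h0]
    exact blockVector_mem_ballotWords hk hpf h0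
  · intro π hπ π' hπ' hw
    obtain ⟨hpf, rfl, -, -, rfl⟩ := (hmem π).1 hπ
    obtain ⟨hpf', h1, -, -, h2⟩ := (hmem π').1 hπ'
    refine eq_of_forall_blockVector_eq hk hpf hpf' ?_ (congrFun hw)
    rw [← colouringSide_false_blockColouring hk hpf, ← colouringSide_false_blockColouring hk hpf',
      h1, h2]
  · intro w hw
    obtain ⟨π, hpf, rfl, h0, h1, h2, h3⟩ :=
      exists_parkingFunction_of_mem_ballotWords hk h_nonempty h_disjoint hf hT hw
    refine ⟨π, (hmem π).2 ⟨hpf, rfl, ?_, ?_, ?_⟩, funext h3⟩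
    · funext c
      rw [← (mem_blockColourings.1 hf).2.2.1 c]
      exact congrArg Finset.card (congrFun h1 c)
    · funext c
      rw [← (mem_blockColourings.1 hf).2.2.2 c, leadingBlock_eq hk (hpf.1 0)]
      exact congrArg Finset.card (congrFun h2 c)
    · refine colouring_ext fun b => ?_
      cases b
      · rw [colouringSide_false_blockColouring hk hpf, h1]
      · rw [colouringSide_true_blockColouring hk hpf h0, h2]

/-! ### The count and its symmetry -/

theorem succ_mul_card_parkingFunctions {k N : ℕ} (hk : 0 < k)
    {𝒪 : Finset (Fin k → Finset (Fin (N + 1)))}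
    (h_nonempty : ∀ S ∈ 𝒪, S ≠ fun _ => ∅)
    (h_disjoint : ∀ S ∈ 𝒪, ∀ T ∈ 𝒪, ∀ c d : Fin k, (S, c) ≠ (T, d) → Disjoint (S c) (T d))
    (h_first : ∀ S ∈ 𝒪, ∀ c : Fin k, (0 : Fin (N + 1)) ∉ S c)
    {u v : Fin k → ℕ} (huv : u ≠ v) :
    (N + 1) * (((abParkingFunctions k k (N + 1)).filter
        fun π => otherBlockVectors k π = 𝒪).filter
      fun π => blockCounts k π 1 = u ∧ blockCounts k π (leadingBlock k π) = v).card =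
    (blockColourings k (unionOfEntries 𝒪) u v).card * (∑ c, u c) *
      (N + 1).descFactorial (𝒪.card + 1) := by
  rw [Finset.card_eq_sum_card_fiberwise (f := blockColouring hk (unionOfEntries 𝒪))
    (t := blockColourings k (unionOfEntries 𝒪) u v), Finset.mul_sum, mul_assoc, ← smul_eq_mul,
    ← Finset.sum_const]
  · refine Finset.sum_congr rfl fun f hf => ?_
    obtain ⟨c₀, h₀⟩ := (mem_blockColourings.1 hf).2.1
    have h₀' := mem_colouringSide.2 h₀
    -- Car 1 separates the leading vector from `𝒪`, so there are exactly `𝒪.card + 1` letters.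
    have hT : colouringSide f true ∉ 𝒪 := fun h => h_first _ h c₀ h₀'
    rw [card_filter_blockColouring hk h_nonempty h_disjoint huv hf hT,
      succ_mul_card_ballotWords, Finset.card_insert_of_notMem hT]
    · simp
    · intro x hx
      refine Nat.pos_of_ne_zero fun h => hx (funext fun c => ?_)
      rw [Finset.sum_eq_zero_iff] at h
      exact Finset.card_eq_zero.1 (h c (Finset.mem_univ c))
    · rw [Finset.mem_insert, not_or]
      refine ⟨fun he => ?_, fun he => h_nonempty _ he rfl⟩
      rw [← he] at h₀'
      simp at h₀'
    · exact sum_add_sum_insert_eq h_disjoint hf hT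
  · intro π hπ
    simp only [abParkingFunctions, Finset.coe_filter, Finset.mem_filter,
      Set.Finite.mem_toFinset, Set.mem_ofPred_eq, and_assoc] at hπ
    obtain ⟨hpf, rfl, rfl, rfl⟩ := hπ
    exact blockColouring_mem hk hpf (leadingBlock_ne_of_blockCounts_ne hk (hpf.1 0) huv)

theorem proposition8p2 (n k : ℕ) [NeZero n] (hk : 1 ≤ k)
    (𝒪 : Finset (Fin k → Finset (Fin n)))
    (h_nonempty : ∀ S ∈ 𝒪, S ≠ fun _ => ∅)
    (h_disjoint : ∀ S ∈ 𝒪, ∀ T ∈ 𝒪, ∀ c d : Fin k, (S, c) ≠ (T, d) → Disjoint (S c) (T d))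
    (h_first : ∀ S ∈ 𝒪, ∀ c : Fin k, (0 : Fin n) ∉ S c) :
    HasSymmetricJointDistribution
      ((abParkingFunctions k k n).filter fun π => otherBlockVectors k π = 𝒪)
      (fun π => blockCounts k π 1)
      (fun π => blockCounts k π (leadingBlock k π)) := by
  intro u v
  rcases eq_or_ne u v with rfl | huv
  · rfl
  obtain ⟨N, rfl⟩ := Nat.exists_eq_succ_of_ne_zero (NeZero.ne n)
  refine Nat.eq_of_mul_eq_mul_left (Nat.succ_pos N) ?_
  refine (succ_mul_card_parkingFunctions hk h_nonempty h_disjoint h_first huv).trans ?_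
  rw [card_blockColourings_mul_sum]
  exact (succ_mul_card_parkingFunctions hk h_nonempty h_disjoint h_first huv.symm).symm
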